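/- Let $\Gamma$ be a finite set with $N>1$ elements. Let $\mathcal D_N$ be the Dyck inverse monoid (polycyclic monoid): the monoid with zero generated by $\gamma(-),\gamma(+)$, $\gamma\in\Gamma$, with the relations $\gamma(-)\gamma(+)=\mathbf 1$ and $\gamma(-)\gamma'(+)=0$ for $\gamma\neq\gamma'$. Consider the directed labeled graph with two vertices $v_{even}$ and $v_{odd}$, an edge from $v_{even}$ to $v_{odd}$ labeled $0$, an edge from $v_{odd}$ to $v_{even}$ labeled $0$, a loop at $v_{even}$ labeled $1$, and, for each $\gamma\in\Gamma$, two further loops $e(\gamma(-))$ and $e(\gamma(+))$ at $v_{even}$, each labeled by itself. Set $\varphi(0)=\varphi(1)=\mathbf 1$, $\varphi(e(\gamma(-)))=\gamma(-)$, $\varphi(e(\gamma(+)))=\gamma(+)$, and call a finite path with label sequence $(\sigma_i)_{1\le i\le I}$ admissible if $\prod_{1\le i\le I}\varphi(\sigma_i)\neq 0$ in $\mathcal D_N$. The Schröder shift $Sch_N$ is the subshift with alphabet $\{0,1\}\cup\{e(\gamma(-)),e(\gamma(+)):\gamma\in\Gamma\}$ whose admissible words are the label sequences of admissible paths; that is,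 it consists of all bi-infinite sequences in which every finite word is the label sequence of an admissible path. For a subshift $X$ let $\mathcal L_n(X)$ be the set of words of length $n$ that appear in points of $X$, and let $h(X)=\lim_{n\to\infty}\frac1n\log\operatorname{card}\mathcal L_n(X)$ be its topological entropy. Then, for every $N>1$, this limit exists for $X=Sch_N$ and $$h(Sch_N)=\log 2-\log\left(\sqrt{(N+2)^2+4}-N-2\right).$$ -/

import Mathlib

namespace DyckExtension

open SymbolicDynamics.FullShift

/-! ### The Dyck inverse monoid -/

/-- Generators of the Dyck inverse monoid over `Γ`: `γ(-)`, `γ(+)` for `γ ∈ Γ`, and the zero. -/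
inductive DyckGen (Γ : Type*)
  | neg (γ : Γ)
  | pos (γ : Γ)
  | zero

/-- Defining relations of the Dyck inverse monoid: `γ(-) γ(+) = 1`, `γ(-) γ'(+) = 0` for `γ ≠ γ'`,
and `0` is absorbing. -/
inductive DyckRel (Γ : Type*) : FreeMonoid (DyckGen Γ) → FreeMonoid (DyckGen Γ) → Prop
  | cancel (γ : Γ) :
      DyckRel Γ (FreeMonoid.of (DyckGen.neg γ) * FreeMonoid.of (DyckGen.pos γ)) 1
  | mismatch (γ γ' : Γ) (h : γ ≠ γ') :
      DyckRel Γ (FreeMonoid.of (DyckGen.neg γ) * FreeMonoid.of (DyckGen.pos γ'))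
        (FreeMonoid.of DyckGen.zero)
  | zero_mul (g : DyckGen Γ) :
      DyckRel Γ (FreeMonoid.of DyckGen.zero * FreeMonoid.of g) (FreeMonoid.of DyckGen.zero)
  | mul_zero (g : DyckGen Γ) :
      DyckRel Γ (FreeMonoid.of g * FreeMonoid.of DyckGen.zero) (FreeMonoid.of DyckGen.zero)

/-- The Dyck inverse monoid (polycyclic monoid) over `Γ`, by generators and relations. -/
abbrev DyckMonoid (Γ : Type*) : Type _ := PresentedMonoid (DyckRel Γ)

/-- The generator `γ(-)`. -/
def DyckMonoid.neg {Γ : Type*} (γ : Γ) : DyckMonoid Γ :=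
  PresentedMonoid.of (DyckRel Γ) (DyckGen.neg γ)

/-- The generator `γ(+)`. -/
def DyckMonoid.pos {Γ : Type*} (γ : Γ) : DyckMonoid Γ :=
  PresentedMonoid.of (DyckRel Γ) (DyckGen.pos γ)

/-- The zero element. -/
def DyckMonoid.zero {Γ : Type*} : DyckMonoid Γ :=
  PresentedMonoid.of (DyckRel Γ) DyckGen.zero

/-! ### Subshifts given by their words, and topological entropy -/

/-- The word `x_i x_{i+1} … x_{i+n-1}` that appears in the point `x` at the position `i`. -/
def wordAt {A : Type*} (x : ℤ → A) (i : ℤ) (n : ℕ) : List A :=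
  List.ofFn fun k : Fin n => x (i + (k : ℕ))

/-- The subshift of all points in which only words from `W` appear. -/
def subshiftOfWords {A : Type*} [TopologicalSpace A] [DiscreteTopology A] (W : Set (List A)) :
    Subshift A ℤ where
  carrier := {x | ∀ (i : ℤ) (n : ℕ), wordAt x i n ∈ W}
  isClosed := by
    simp only [Set.ofPred_forall]
    refine isClosed_iInter fun i => isClosed_iInter fun n => ?_
    have hc : Continuous fun (x : ℤ → A) (k : Fin n) => x (i + (k : ℕ)) := by fun_prop
    exact (isClosed_discrete {w : Fin n → A | List.ofFn w ∈ W}).preimage hc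
  mapsTo := by
    intro g x hx i n
    have h : wordAt (shift g x) i n = wordAt x (g + i) n := by
      simp [wordAt, add_assoc]
    rw [h]
    exact hx (g + i) n

/-- The set `L_n(X)` of admissible words of length `n` of the subshift `X`, i.e. of the words of
length `n` that appear somewhere in a point of `X`. -/
def admissibleWords {A : Type*} [TopologicalSpace A] (X : Subshift A ℤ) (n : ℕ) :
    Set (List A) :=
  {w | ∃ x ∈ X.carrier, ∃ i : ℤ, w = wordAt x i n}

/-- `HasTopologicalEntropy X h`: the limit of `(1/n) log card L_n(X)` exists and equals `h`. -/
def HasTopologicalEntropy {A : Type*} [TopologicalSpace A] [Finite A] (X : Subshift A ℤ)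
    (h : ℝ) : Prop :=
  Filter.Tendsto (fun n : ℕ => 1 / (n : ℝ) * Real.log ((admissibleWords X n).ncard : ℝ))
    Filter.atTop (nhds h)

/-! ### Attaching loops to a labeled graph -/

/-- Directed labeled graphs with vertex set `V`, edge set `E` and label alphabet `A`. -/
structure LabeledGraph (V E A : Type*) where
  src : E → V
  tgt : E → V
  label : E → A

/-- Finite paths in a directed graph, as lists of consecutive edges. -/
def LabeledGraph.IsPath {V E A : Type*} (G : LabeledGraph V E A) (p : List E) : Prop :=
  p.IsChain fun e f => G.tgt e = G.src f

/-- The set `T` together with symbols `e(γ(-), k)`, `k < Km γ`, and `e(γ(+), k)`, `k < Kp γ`. -/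
inductive WithLoops {Γ : Type*} (T : Type*) (Km Kp : Γ → ℕ)
  | base (t : T)
  | neg (γ : Γ) (k : Fin (Km γ))
  | pos (γ : Γ) (k : Fin (Kp γ))

instance {Γ T : Type*} (Km Kp : Γ → ℕ) [Finite Γ] [Finite T] : Finite (WithLoops T Km Kp) := by
  let f : T ⊕ (Σ γ, Fin (Km γ)) ⊕ (Σ γ, Fin (Kp γ)) → WithLoops T Km Kp
    | .inl t => .base t
    | .inr (.inl s) => .neg s.1 s.2
    | .inr (.inr s) => .pos s.1 s.2
  refine Finite.of_surjective f fun s => ?_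
  cases s with
  | base t => exact ⟨.inl t, rfl⟩
  | neg γ k => exact ⟨.inr (.inl ⟨γ, k⟩), rfl⟩
  | pos γ k => exact ⟨.inr (.inr ⟨γ, k⟩), rfl⟩

/-- The alphabet carries the discrete topology. -/
instance {Γ T : Type*} (Km Kp : Γ → ℕ) : TopologicalSpace (WithLoops T Km Kp) := ⊥

instance {Γ T : Type*} (Km Kp : Γ → ℕ) : DiscreteTopology (WithLoops T Km Kp) := ⟨rfl⟩

/-- The graph obtained from `G` by attaching to the vertex `v` the loops `e(γ(-), k)`, `k < Km γ`,
and `e(γ(+), k)`, `k < Kp γ`, each of them labeled by itself. -/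
def LabeledGraph.attachLoops {Γ V E A : Type*} (G : LabeledGraph V E A) (v : V) (Km Kp : Γ → ℕ) :
    LabeledGraph V (WithLoops E Km Kp) (WithLoops A Km Kp) where
  src
    | .base e => G.src e
    | .neg _ _ => v
    | .pos _ _ => v
  tgt
    | .base e => G.tgt e
    | .neg _ _ => v
    | .pos _ _ => v
  label
    | .base e => .base (G.label e)
    | .neg γ k => .neg γ k
    | .pos γ k => .pos γ k

/-- The map `φ` from the label alphabet to the Dyck inverse monoid: `σ ↦ 1` for an original label
`σ`, `e(γ(-), k) ↦ γ(-)` and `e(γ(+), k) ↦ γ(+)`. -/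
def dyckValue {Γ A : Type*} (Km Kp : Γ → ℕ) : WithLoops A Km Kp → DyckMonoid Γ
  | .base _ => 1
  | .neg γ _ => DyckMonoid.neg γ
  | .pos γ _ => DyckMonoid.pos γ

/-- A path of the graph with loops attached is admissible if the product of the `φ`-images of its
labels is not zero, i.e. if the sequence of these images is admissible for the Motzkin shift. -/
def IsAdmissiblePath {Γ V E A : Type*} (G : LabeledGraph V E A) (v : V) (Km Kp : Γ → ℕ)
    (p : List (WithLoops E Km Kp)) : Prop :=
  (G.attachLoops v Km Kp).IsPath p ∧
    (p.map fun e => dyckValue Km Kp ((G.attachLoops v Km Kp).label e)).prod ≠ DyckMonoid.zero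

/-- The subshift whose admissible words are the label sequences of admissible paths. -/
def loopSubshift {Γ V E A : Type*} (G : LabeledGraph V E A) (v : V) (Km Kp : Γ → ℕ) :
    Subshift (WithLoops A Km Kp) ℤ :=
  subshiftOfWords
    {w | ∃ p, IsAdmissiblePath G v Km Kp p ∧ w = p.map (G.attachLoops v Km Kp).label}

/-! ### The Schröder shift -/

/-- Vertices of the Fischer automaton of the even system. -/
inductive EvenVertex
  | even
  | odd

/-- Edges of the Fischer automaton of the even system. -/
inductive EvenEdge
  | evenToOdd
  | oddToEven
  | loop

/-- The Fischer automaton of the even system: the edges between the two vertices have label `0`,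
the loop at the vertex `even` has label `1`. -/
def evenAutomaton : LabeledGraph EvenVertex EvenEdge (Fin 2) where
  src
    | .evenToOdd => .even
    | .oddToEven => .odd
    | .loop => .even
  tgt
    | .evenToOdd => .odd
    | .oddToEven => .even
    | .loop => .even
  label
    | .evenToOdd => 0
    | .oddToEven => 0
    | .loop => 1

/-- The Schröder shift over `Γ`: one loop `e(γ(-))` and one loop `e(γ(+))` for every `γ ∈ Γ` are
attached to the vertex `even` of the Fischer automaton of the even system. -/
def schroederShift (Γ : Type*) :
    Subshift (WithLoops (Fin 2) (fun _ : Γ => 1) (fun _ : Γ => 1)) ℤ :=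
  loopSubshift evenAutomaton EvenVertex.even (fun _ => 1) (fun _ => 1)

end DyckExtension

/-! Cancelling `γ(-)γ(+)` factors any path of nonzero value as `p₁ p₂`, where `p₁` has value a
product of `γ(+)`'s and `p₂` a product of `γ(-)`'s (`exists_append_of_pathValue_ne_zero`). Reversing
`p₂` and exchanging signs turns it into a path of the first kind, so up to the choice of the cut, a
polynomial factor, only that kind has to be counted.

Let `γ(+)` push and `γ(-)` pop on infinite stacks, the rightmost factor acting first. A path whose
value is a product of pushes never fails on a fixed stack `s`. In a path that does not fail, the
symbol of each `γ(-)` is dictated by the current stack, so it need not be recorded. The resulting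
codes satisfy `a (n+1) = (N+2) * a n + b n` and `b (n+1) = a n` for the initial vertices `even` and
`odd`, hence grow like `r ^ n` with `r ^ 2 = (N+2) * r + 1`.

Codes from `even` give distinct admissible words, which bounds the language from below
(`natCard_pathCode_le_ncard`); pairs of codes cover it (`ncard_le_sum_natCard_pathCode`). The
entropy is therefore `log r`, with `r` the positive root. -/

namespace DyckExtension

open MulOpposite

/-! ### The Dyck inverse monoid: transposition and action on stacks -/

section Monoid

variable {Γ : Type*}

namespace DyckMonoid

theorem neg_mul_pos (γ : Γ) : neg γ * pos γ = 1 :=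
  PresentedMonoid.mk_eq_mk_of_rel (DyckRel.cancel γ)

theorem neg_mul_pos_of_ne {γ γ' : Γ} (h : γ ≠ γ') : neg γ * pos γ' = zero :=
  PresentedMonoid.mk_eq_mk_of_rel (DyckRel.mismatch γ γ' h)

theorem zero_mul (x : DyckMonoid Γ) : zero * x = zero := by
  induction x using PresentedMonoid.inductionOn with
  | h a =>
    induction a using FreeMonoid.inductionOn' with
    | one => simp
    | of_mul g a ih =>
      have h : zero * PresentedMonoid.mk (DyckRel Γ) (FreeMonoid.of g) = zero :=
        PresentedMonoid.mk_eq_mk_of_rel (DyckRel.zero_mul g)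
      rw [map_mul, ← mul_assoc, h, ih]

theorem mul_zero (x : DyckMonoid Γ) : x * zero = zero := by
  induction x using PresentedMonoid.inductionOn with
  | h a =>
    induction a using FreeMonoid.inductionOn' with
    | one => simp
    | of_mul g a ih =>
      have h : PresentedMonoid.mk (DyckRel Γ) (FreeMonoid.of g) * zero = zero :=
        PresentedMonoid.mk_eq_mk_of_rel (DyckRel.mul_zero g)
      rw [map_mul, mul_assoc, ih, h]

/-- The anti-automorphism of the Dyck inverse monoid that exchanges `γ(-)` and `γ(+)`. -/
def transpose : DyckMonoid Γ →* (DyckMonoid Γ)ᵐᵒᵖ :=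
  PresentedMonoid.lift
    (fun
      | .neg γ => op (pos γ)
      | .pos γ => op (neg γ)
      | .zero => op zero)
    (by
      rintro _ _ (γ | ⟨γ, γ', h⟩ | g | g)
      · simp [← op_mul, neg_mul_pos]
      · simp [← op_mul, neg_mul_pos_of_ne h.symm]
      · cases g <;> simp [← op_mul, mul_zero]
      · cases g <;> simp [← op_mul, zero_mul])

@[simp] theorem transpose_neg (γ : Γ) : transpose (neg γ) = op (pos γ) := rfl

@[simp] theorem transpose_pos (γ : Γ) : transpose (pos γ) = op (neg γ) := rfl

/-- Infinite stacks of symbols from `Γ`, together with the error state `none`. -/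
abbrev StackState (Γ : Type*) := Option (ℕ → Γ)

/-- The stack `s` with the symbol `γ` on top. -/
def pushStack (γ : Γ) (s : ℕ → Γ) : ℕ → Γ
  | 0 => γ
  | n + 1 => s n

/-- `pushState γ` pushes the symbol `γ`. -/
def pushState (γ : Γ) : StackState Γ → StackState Γ :=
  Option.map (pushStack γ)

open Classical in
/-- `popState γ` removes the top symbol if it is `γ`, and fails otherwise. -/
noncomputable def popState (γ : Γ) : StackState Γ → StackState Γ
  | none => none
  | some s => if s 0 = γ then some fun n => s (n + 1) else none

theorem popState_pushState (γ : Γ) (s : StackState Γ) : popState γ (pushState γ s) = s := by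
  cases s <;> simp [popState, pushState, pushStack]

theorem popState_pushState_of_ne {γ γ' : Γ} (h : γ ≠ γ') (s : StackState Γ) :
    popState γ (pushState γ' s) = none := by
  cases s <;> simp [popState, pushState, pushStack, h.symm]

/-- The action of the Dyck inverse monoid on infinite stacks. -/
noncomputable def stackAction : DyckMonoid Γ →* Function.End (StackState Γ) :=
  PresentedMonoid.lift
    (fun
      | .neg γ => popState γ
      | .pos γ => pushState γ
      | .zero => fun _ => none)
    (by
      rintro _ _ (γ | ⟨γ, γ', h⟩ | g | g)
      · exact funext (popState_pushState γ)
      · exact funext (popState_pushState_of_ne h)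
      · cases g <;> rfl
      · cases g <;> rfl)

@[simp] theorem stackAction_neg (γ : Γ) : stackAction (neg γ) = popState γ := rfl

@[simp] theorem stackAction_pos (γ : Γ) : stackAction (pos γ) = pushState γ := rfl

theorem stackAction_mul (x y : DyckMonoid Γ) (s : StackState Γ) :
    stackAction (x * y) s = stackAction x (stackAction y s) := by
  rw [map_mul]
  rfl

/-- Zero sends every state to `none`, so one stack without failure certifies that a value is
nonzero. -/
theorem ne_zero_of_stackAction {x : DyckMonoid Γ} {s : StackState Γ} {t : ℕ → Γ}
    (h : stackAction x s = some t) : x ≠ zero := by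
  rintro rfl
  exact Option.some_ne_none t (show (none : StackState Γ) = some t from h).symm

theorem exists_stackAction_prod_pos (u : List Γ) (s : ℕ → Γ) :
    ∃ t, stackAction (u.map pos).prod (some s) = some t := by
  induction u with
  | nil => exact ⟨s, rfl⟩
  | cons γ u ih =>
    obtain ⟨t, ht⟩ := ih
    refine ⟨pushStack γ t, ?_⟩
    rw [List.map_cons, List.prod_cons, stackAction_mul, ht]
    rfl

theorem transpose_prod_neg (v : List Γ) :
    transpose (v.map neg).prod = op (v.reverse.map pos).prod := by
  induction v with
  | nil => rfl
  | cons γ v ih => simp [ih, ← op_mul]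

end DyckMonoid

end Monoid

end DyckExtension

namespace DyckExtension

universe u

open MulOpposite

/-! ### Paths, their reversal, and their codes -/

section Paths

variable {Γ : Type u}

/-- The edges of the Fischer automaton of the even system with loops attached. -/
abbrev SchroederEdge (Γ : Type u) := WithLoops EvenEdge (fun _ : Γ => 1) (fun _ : Γ => 1)

/-- The alphabet of the Schröder shift. -/
abbrev SchroederLetter (Γ : Type u) := WithLoops (Fin 2) (fun _ : Γ => 1) (fun _ : Γ => 1)

/-- The graph that presents the Schröder shift. -/
abbrev schroederGraph (Γ : Type u) : LabeledGraph EvenVertex (SchroederEdge Γ) (SchroederLetter Γ) :=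
  evenAutomaton.attachLoops EvenVertex.even (fun _ => 1) (fun _ => 1)

/-- The product in the Dyck inverse monoid of the values of the labels of a list of edges. -/
def pathValue (p : List (SchroederEdge Γ)) : DyckMonoid Γ :=
  (p.map fun e => dyckValue _ _ ((schroederGraph Γ).label e)).prod

@[simp] theorem pathValue_nil : pathValue ([] : List (SchroederEdge Γ)) = 1 := rfl

@[simp] theorem pathValue_cons (e : SchroederEdge Γ) (p : List (SchroederEdge Γ)) :
    pathValue (e :: p) = dyckValue _ _ ((schroederGraph Γ).label e) * pathValue p := by
  simp [pathValue]

@[simp] theorem pathValue_append (p q : List (SchroederEdge Γ)) :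
    pathValue (p ++ q) = pathValue p * pathValue q := by
  simp [pathValue]

@[simp] theorem dyckValue_label_base (e : EvenEdge) :
    dyckValue _ _ ((schroederGraph Γ).label (.base e)) = (1 : DyckMonoid Γ) := rfl

@[simp] theorem dyckValue_label_neg (γ : Γ) (k : Fin 1) :
    dyckValue _ _ ((schroederGraph Γ).label (.neg γ k)) = DyckMonoid.neg γ := rfl

@[simp] theorem dyckValue_label_pos (γ : Γ) (k : Fin 1) :
    dyckValue _ _ ((schroederGraph Γ).label (.pos γ k)) = DyckMonoid.pos γ := rfl

/-- A list of edges of nonzero value is the concatenation of a list whose value is a product of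
generators `γ(+)` and one whose value is a product of generators `γ(-)`. -/
theorem exists_append_of_pathValue_ne_zero (p : List (SchroederEdge Γ))
    (hp : pathValue p ≠ DyckMonoid.zero) :
    ∃ p₁ p₂ u v, p = p₁ ++ p₂ ∧ pathValue p₁ = (List.map DyckMonoid.pos u).prod ∧
      pathValue p₂ = (List.map DyckMonoid.neg v).prod := by
  induction p with
  | nil => exact ⟨[], [], [], [], rfl, rfl, rfl⟩
  | cons e p ih =>
    obtain ⟨p₁, p₂, u, v, rfl, h₁, h₂⟩ := ih fun h => hp (by
      rw [pathValue_cons, h, DyckMonoid.mul_zero])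
    rcases e with e | ⟨γ, k⟩ | ⟨γ, k⟩
    · exact ⟨.base e :: p₁, p₂, u, v, rfl, by simp [h₁], h₂⟩
    · cases u with
      -- With no `γ'(+)` left to cancel, `p₁` has value `1` and is absorbed into the second factor.
      | nil =>
        exact ⟨[], .neg γ k :: (p₁ ++ p₂), [], γ :: v, rfl, rfl, by simp [h₁, h₂]⟩
      | cons γ' u =>
        by_cases h : γ = γ'
        · subst h
          exact ⟨.neg γ k :: p₁, p₂, u, v, rfl, by
            simp [h₁, ← mul_assoc, DyckMonoid.neg_mul_pos], h₂⟩
        · refine absurd ?_ hp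
          simp [h₁, ← mul_assoc, DyckMonoid.neg_mul_pos_of_ne h, DyckMonoid.zero_mul]
    · exact ⟨.pos γ k :: p₁, p₂, γ :: u, v, rfl, by simp [h₁], h₂⟩

/-- The involution on edges that reverses the cycle of length two and exchanges `e(γ(-))` and
`e(γ(+))`. -/
def flipEdge : SchroederEdge Γ → SchroederEdge Γ
  | .base .evenToOdd => .base .oddToEven
  | .base .oddToEven => .base .evenToOdd
  | .base .loop => .base .loop
  | .neg γ k => .pos γ k
  | .pos γ k => .neg γ k

theorem flipEdge_flipEdge (e : SchroederEdge Γ) : flipEdge (flipEdge e) = e := by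
  rcases e with (_ | _ | _) | _ | _ <;> rfl

theorem src_flipEdge (e : SchroederEdge Γ) :
    (schroederGraph Γ).src (flipEdge e) = (schroederGraph Γ).tgt e := by
  rcases e with (_ | _ | _) | _ | _ <;> rfl

theorem tgt_flipEdge (e : SchroederEdge Γ) :
    (schroederGraph Γ).tgt (flipEdge e) = (schroederGraph Γ).src e := by
  rcases e with (_ | _ | _) | _ | _ <;> rfl

/-- A list of edges read backwards, with all edges flipped. -/
def flipPath (p : List (SchroederEdge Γ)) : List (SchroederEdge Γ) :=
  (p.map flipEdge).reverse

theorem flipPath_flipPath (p : List (SchroederEdge Γ)) : flipPath (flipPath p) = p := by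
  simp [flipPath, Function.comp_def, flipEdge_flipEdge]

theorem isPath_flipPath {p : List (SchroederEdge Γ)} (hp : (schroederGraph Γ).IsPath p) :
    (schroederGraph Γ).IsPath (flipPath p) := by
  unfold LabeledGraph.IsPath flipPath
  rw [List.isChain_reverse, List.isChain_map]
  refine hp.imp fun e f h => ?_
  rw [src_flipEdge, tgt_flipEdge, h]

theorem op_pathValue_flipPath (p : List (SchroederEdge Γ)) :
    op (pathValue (flipPath p)) = DyckMonoid.transpose (pathValue p) := by
  induction p with
  | nil => rfl
  | cons e p ih =>
    have h : flipPath (e :: p) = flipPath p ++ [flipEdge e] := by simp [flipPath]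
    rw [h, pathValue_append, op_mul, ih, pathValue_cons (e := e), map_mul]
    congr 1
    rcases e with (_ | _ | _) | _ | _ <;> simp [flipEdge]

/-- Reduces the second factor of an admissible path to the kind that never fails on a stack. -/
theorem pathValue_flipPath_of_prod_neg {p : List (SchroederEdge Γ)} {v : List Γ}
    (h : pathValue p = (v.map DyckMonoid.neg).prod) :
    pathValue (flipPath p) = (v.reverse.map DyckMonoid.pos).prod :=
  op_injective (by rw [op_pathValue_flipPath, h, DyckMonoid.transpose_prod_neg])

/-- The path `p` can start at the vertex `v`. -/
def StartsAt (v : EvenVertex) (p : List (SchroederEdge Γ)) : Prop :=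
  (∀ e ∈ p.head?, v = (schroederGraph Γ).src e) ∧ (schroederGraph Γ).IsPath p

theorem startsAt_cons {v : EvenVertex} {e : SchroederEdge Γ} {p : List (SchroederEdge Γ)} :
    StartsAt v (e :: p) ↔
      v = (schroederGraph Γ).src e ∧ StartsAt ((schroederGraph Γ).tgt e) p := by
  simp [StartsAt, LabeledGraph.IsPath, List.isChain_cons]

theorem exists_startsAt {p : List (SchroederEdge Γ)} (hp : (schroederGraph Γ).IsPath p) :
    ∃ v, StartsAt v p := by
  cases p with
  | nil => exact ⟨.even, by simp, hp⟩
  | cons e p => exact ⟨(schroederGraph Γ).src e, by simp, hp⟩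

/-- Codes for the paths of length `n` from a vertex that act on a given infinite stack without
failure: the symbol of an edge `e(γ(-))` is not recorded. -/
def PathCode (Γ : Type u) : ℕ → EvenVertex → Type u
  | 0, _ => PUnit
  | n + 1, .even => (Option (Option Γ) × PathCode Γ n .even) ⊕ PathCode Γ n .odd
  | n + 1, .odd => PathCode Γ n .even

/-- The path described by a code, and the stack obtained from `s` by this path. -/
def PathCode.decode (s : ℕ → Γ) :
    ∀ {n : ℕ} {v : EvenVertex}, PathCode Γ n v → List (SchroederEdge Γ) × (ℕ → Γ)
  | 0, _, _ => ([], s)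
  | _ + 1, .even, .inl (none, c) =>
    let q := PathCode.decode s c
    (.base .loop :: q.1, q.2)
  | _ + 1, .even, .inl (some none, c) =>
    let q := PathCode.decode s c
    -- The tail acts first; the top of the stack it leaves is the only symbol that can be popped
    -- without failure.
    (.neg (q.2 0) 0 :: q.1, fun n => q.2 (n + 1))
  | _ + 1, .even, .inl (some (some γ), c) =>
    let q := PathCode.decode s c
    (.pos γ 0 :: q.1, DyckMonoid.pushStack γ q.2)
  | n + 1, .even, .inr c =>
    let q := PathCode.decode (n := n) (v := .odd) s c
    (.base .evenToOdd :: q.1, q.2)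
  | n + 1, .odd, c =>
    let q := PathCode.decode (n := n) (v := .even) s c
    (.base .oddToEven :: q.1, q.2)

namespace PathCode

variable (s : ℕ → Γ)

theorem length_decode {n : ℕ} {v : EvenVertex} (c : PathCode Γ n v) :
    (c.decode s).1.length = n := by
  induction n generalizing v with
  | zero => rfl
  | succ n ih =>
    cases v with
    | even => rcases c with ⟨_ | _ | γ, c⟩ | c <;> simp [decode, ih]
    | odd => simp [decode, ih (v := .even) c]

theorem startsAt_decode {n : ℕ} {v : EvenVertex} (c : PathCode Γ n v) :
    StartsAt v (c.decode s).1 := by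
  induction n generalizing v with
  | zero => exact ⟨by simp [decode], List.isChain_nil⟩
  | succ n ih =>
    cases v with
    | even => rcases c with ⟨_ | _ | γ, c⟩ | c <;> exact startsAt_cons.2 ⟨rfl, ih _⟩
    | odd => exact startsAt_cons.2 ⟨rfl, ih _⟩

theorem stackAction_decode {n : ℕ} {v : EvenVertex} (c : PathCode Γ n v) :
    DyckMonoid.stackAction (pathValue (c.decode s).1) (some s) = some (c.decode s).2 := by
  induction n generalizing v with
  | zero => rfl
  | succ n ih =>
    cases v with
    | even =>
      rcases c with ⟨_ | _ | γ, c⟩ | c <;>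
        simp [decode, DyckMonoid.stackAction_mul, ih, DyckMonoid.popState, DyckMonoid.pushState]
    | odd => simp [decode, ih (v := .even) c]

/-- Completeness of the codes: a successful pop forces its symbol to be the top of the stack, so
nothing is lost by not recording it. -/
theorem exists_decode_eq {v : EvenVertex} {p : List (SchroederEdge Γ)} (hp : StartsAt v p)
    {t : ℕ → Γ} (ht : DyckMonoid.stackAction (pathValue p) (some s) = some t) :
    ∃ c : PathCode Γ p.length v, c.decode s = (p, t) := by
  induction p generalizing v t with
  | nil =>
    obtain rfl : s = t := Option.some_injective _ ht
    exact ⟨PUnit.unit, rfl⟩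
  | cons e p ih =>
    obtain ⟨rfl, hq⟩ := startsAt_cons.1 hp
    rw [pathValue_cons, DyckMonoid.stackAction_mul] at ht
    rcases h : DyckMonoid.stackAction (pathValue p) (some s) with _ | r
    -- Failure is permanent: `none` is fixed by every generator that labels an edge.
    · exfalso
      rw [h] at ht
      rcases e with _ | _ | _ <;>
        simp [DyckMonoid.popState, DyckMonoid.pushState, Function.End.one_def] at ht
    rw [h] at ht
    rcases e with (_ | _ | _) | ⟨γ, k⟩ | ⟨γ, k⟩
    · obtain rfl : r = t := Option.some_injective _ ht
      obtain ⟨c, hc⟩ := ih (v := .odd) hq h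
      exact ⟨.inr c, congrArg (fun q => (.base .evenToOdd :: q.1, q.2)) hc⟩
    · obtain rfl : r = t := Option.some_injective _ ht
      obtain ⟨c, hc⟩ := ih (v := .even) hq h
      exact ⟨c, congrArg (fun q => (.base .oddToEven :: q.1, q.2)) hc⟩
    · obtain rfl : r = t := Option.some_injective _ ht
      obtain ⟨c, hc⟩ := ih (v := .even) hq h
      exact ⟨.inl (none, c), congrArg (fun q => (.base .loop :: q.1, q.2)) hc⟩
    · obtain ⟨rfl, rfl⟩ : r 0 = γ ∧ (fun n => r (n + 1)) = t := by
        simpa [DyckMonoid.popState] using ht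
      obtain rfl := Subsingleton.elim 0 k
      obtain ⟨c, hc⟩ := ih (v := .even) hq h
      exact ⟨.inl (some none, c),
        congrArg (fun q => (.neg (q.2 0) 0 :: q.1, fun n => q.2 (n + 1))) hc⟩
    · obtain rfl : DyckMonoid.pushStack γ r = t := Option.some_injective _ ht
      obtain rfl := Subsingleton.elim 0 k
      obtain ⟨c, hc⟩ := ih (v := .even) hq h
      exact ⟨.inl (some (some γ), c),
        congrArg (fun q => (.pos γ 0 :: q.1, DyckMonoid.pushStack γ q.2)) hc⟩

/-- The label sequence of the path described by a code. -/
def labels {n : ℕ} {v : EvenVertex} (c : PathCode Γ n v) : List (SchroederLetter Γ) :=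
  (c.decode s).1.map (schroederGraph Γ).label

/-- Edges leaving a given vertex have distinct labels, so the first label determines the branch of
the code and the remaining labels determine its tail. -/
theorem labels_injective (n : ℕ) (v : EvenVertex) :
    Function.Injective (labels s : PathCode Γ n v → List (SchroederLetter Γ)) := by
  induction n generalizing v with
  | zero => exact fun _ _ _ => rfl
  | succ n ih =>
    cases v with
    | even =>
      rintro (⟨_ | _ | γ, c⟩ | c) (⟨_ | _ | γ', c'⟩ | c') h <;>
        simp only [labels, decode, List.map_cons, List.cons.injEq, LabeledGraph.attachLoops,
          evenAutomaton, WithLoops.base.injEq, WithLoops.pos.injEq, WithLoops.neg.injEq,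
          reduceCtorEq, false_and, zero_ne_one, one_ne_zero] at h
      all_goals
        obtain rfl := ih _ h.2
        first | rfl | rw [h.1.1]
    | odd =>
      intro c c' h
      simp only [labels, decode, List.map_cons, List.cons.injEq] at h
      exact ih .even h.2

instance [Finite Γ] (n : ℕ) (v : EvenVertex) : Finite (PathCode Γ n v) := by
  induction n generalizing v with
  | zero => exact inferInstanceAs (Finite PUnit)
  | succ n ih =>
    have := ih .even
    have := ih .odd
    cases v with
    | even =>
      exact inferInstanceAs
        (Finite ((Option (Option Γ) × PathCode Γ n .even) ⊕ PathCode Γ n .odd))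
    | odd => exact ih .even

theorem natCard_zero (v : EvenVertex) : Nat.card (PathCode Γ 0 v) = 1 :=
  Nat.card_unique (α := PUnit)

theorem natCard_succ_odd (n : ℕ) :
    Nat.card (PathCode Γ (n + 1) .odd) = Nat.card (PathCode Γ n .even) := rfl

theorem natCard_succ_even [Finite Γ] (n : ℕ) :
    Nat.card (PathCode Γ (n + 1) .even) =
      (Nat.card Γ + 2) * Nat.card (PathCode Γ n .even) + Nat.card (PathCode Γ n .odd) := by
  change Nat.card ((Option (Option Γ) × PathCode Γ n .even) ⊕ PathCode Γ n .odd) = _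
  rw [Nat.card_sum, Nat.card_prod, Finite.card_option, Finite.card_option]

end PathCode

end Paths

end DyckExtension

namespace DyckExtension

open Filter Topology

universe u

/-! ### The language of the shift and its bounds by numbers of codes -/

section Language

variable {Γ : Type u}

/-- The symbol `0` of the even system. -/
abbrev zeroLetter (Γ : Type u) : SchroederLetter Γ := .base 0

/-- The label sequences of admissible paths. -/
def schroederWords (Γ : Type u) : Set (List (SchroederLetter Γ)) :=
  {w | ∃ p, IsAdmissiblePath evenAutomaton EvenVertex.even (fun _ : Γ => 1) (fun _ => 1) p ∧
    w = p.map (schroederGraph Γ).label}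

theorem mem_schroederWords {w : List (SchroederLetter Γ)} :
    w ∈ schroederWords Γ ↔ ∃ p, (schroederGraph Γ).IsPath p ∧ pathValue p ≠ DyckMonoid.zero ∧
      w = p.map (schroederGraph Γ).label := by
  simp only [schroederWords, IsAdmissiblePath, Set.mem_ofPred_eq, and_assoc]
  rfl

theorem mem_schroederWords_of_infix {w w' : List (SchroederLetter Γ)} (h : w' <:+: w)
    (hw : w ∈ schroederWords Γ) : w' ∈ schroederWords Γ := by
  obtain ⟨a, b, rfl⟩ := h
  obtain ⟨p, hp, hv, h⟩ := mem_schroederWords.1 hw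
  obtain ⟨p₁, q₂, rfl, h₁, -⟩ := List.map_eq_append_iff.1 h.symm
  obtain ⟨q₀, q₁, rfl, -, rfl⟩ := List.map_eq_append_iff.1 h₁
  refine mem_schroederWords.2 ⟨q₁, hp.infix ⟨q₀, q₂, rfl⟩, fun h0 => hv ?_, rfl⟩
  rw [pathValue_append, pathValue_append, h0, DyckMonoid.mul_zero, DyckMonoid.zero_mul]

/-- Each vertex is entered by an edge with label `0`, whose value is `1`. -/
theorem cons_zero_mem_schroederWords {w : List (SchroederLetter Γ)} (hw : w ∈ schroederWords Γ) :
    zeroLetter Γ :: w ∈ schroederWords Γ := by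
  obtain ⟨p, hp, hv, rfl⟩ := mem_schroederWords.1 hw
  obtain ⟨v, h, -⟩ := exists_startsAt hp
  obtain ⟨e, he, hl⟩ : ∃ e, evenAutomaton.tgt e = v ∧ evenAutomaton.label e = 0 := by
    cases v
    exacts [⟨.oddToEven, rfl, rfl⟩, ⟨.evenToOdd, rfl, rfl⟩]
  subst he
  refine mem_schroederWords.2 ⟨.base e :: p, List.isChain_cons.2 ⟨h, hp⟩, by simpa using hv, ?_⟩
  exact congrArg (fun a => WithLoops.base a :: p.map (schroederGraph Γ).label) hl.symm

theorem append_zero_mem_schroederWords {w : List (SchroederLetter Γ)} (hw : w ∈ schroederWords Γ) :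
    w ++ [zeroLetter Γ] ∈ schroederWords Γ := by
  obtain ⟨p, hp, hv, rfl⟩ := mem_schroederWords.1 hw
  obtain ⟨v, h⟩ : ∃ v, ∀ e ∈ p.getLast?, (schroederGraph Γ).tgt e = v := by
    cases hl : p.getLast? with
    | none => exact ⟨.even, by simp⟩
    | some e => exact ⟨(schroederGraph Γ).tgt e, by simp⟩
  obtain ⟨e, he, hl⟩ : ∃ e, evenAutomaton.src e = v ∧ evenAutomaton.label e = 0 := by
    cases v
    exacts [⟨.evenToOdd, rfl, rfl⟩, ⟨.oddToEven, rfl, rfl⟩]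
  subst he
  refine mem_schroederWords.2 ⟨p ++ [.base e], ?_, by simpa using hv, ?_⟩
  · refine List.isChain_append.2 ⟨hp, List.isChain_singleton _, fun x hx y hy => ?_⟩
    obtain rfl : WithLoops.base e = y := by simpa using hy
    exact h x hx
  · rw [List.map_append]
    exact congrArg (fun a => p.map (schroederGraph Γ).label ++ [WithLoops.base a]) hl.symm

theorem padded_mem_schroederWords {w : List (SchroederLetter Γ)} (hw : w ∈ schroederWords Γ)
    (a b : ℕ) :
    List.replicate a (zeroLetter Γ) ++ (w ++ List.replicate b (zeroLetter Γ)) ∈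
      schroederWords Γ := by
  induction a with
  | zero =>
    induction b with
    | zero => simpa using hw
    | succ b ih =>
      have := append_zero_mem_schroederWords ih
      simpa [List.replicate_succ'] using this
  | succ a ih => simpa [List.replicate_succ] using cons_zero_mem_schroederWords ih

/-- The point that carries the word `w` at the positions `0, 1, …` and `z` elsewhere. -/
def paddedPoint {A : Type*} (z : A) (w : List A) (i : ℤ) : A :=
  if 0 ≤ i then w.getD i.toNat z else z

theorem wordAt_paddedPoint_infix {A : Type*} (z : A) (w : List A) (i : ℤ) (n : ℕ) :
    ∃ a b, wordAt (paddedPoint z w) i n <:+: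
      List.replicate a z ++ (w ++ List.replicate b z) := by
  -- This much padding on either side contains the window from `i` to `i + n`, whatever the sign of
  -- `i`.
  refine ⟨i.natAbs, i.natAbs + n, ?_⟩
  have h : wordAt (paddedPoint z w) i n =
      ((List.replicate i.natAbs z ++ (w ++ List.replicate (i.natAbs + n) z)).drop
        (i + i.natAbs).toNat).take n := by
    apply List.ext_getElem
    · simp only [wordAt, List.length_ofFn, List.length_take, List.length_drop, List.length_append,
        List.length_replicate]
      omega
    · intro k h₁ h₂
      simp only [wordAt, List.getElem_ofFn, List.getElem_take, List.getElem_drop, paddedPoint,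
        List.getElem_append, List.getElem_replicate, List.length_replicate, List.getD_eq_getElem?_getD]
      split_ifs with h₃ h₄ h₅
      · omega
      · rw [List.getElem?_eq_getElem (by omega), Option.getD_some]
        congr 1
        omega
      · rw [List.getElem?_eq_none (by omega), Option.getD_none]
      · rfl
      · omega
      · rfl
  rw [h]
  exact (List.take_prefix _ _).isInfix.trans (List.drop_suffix _ _).isInfix

theorem wordAt_paddedPoint {A : Type*} (z : A) (w : List A) :
    wordAt (paddedPoint z w) 0 w.length = w := by
  apply List.ext_getElem
  · simp [wordAt]
  · intro k h₁ h₂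
    simp [wordAt, paddedPoint]

/-- Padding with `0` on both sides extends each label sequence of an admissible path to a point of
the shift. -/
theorem admissibleWords_schroederShift (n : ℕ) :
    admissibleWords (schroederShift Γ) n = {w | w ∈ schroederWords Γ ∧ w.length = n} := by
  ext w
  constructor
  · rintro ⟨x, hx, i, rfl⟩
    exact ⟨hx i n, by simp [wordAt]⟩
  · rintro ⟨hw, rfl⟩
    refine ⟨paddedPoint (zeroLetter Γ) w, fun i m => ?_, 0, (wordAt_paddedPoint _ w).symm⟩
    obtain ⟨a, b, h⟩ := wordAt_paddedPoint_infix (zeroLetter Γ) w i m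
    exact mem_schroederWords_of_infix h (padded_mem_schroederWords hw a b)

theorem finite_admissibleWords [Finite Γ] (n : ℕ) :
    (admissibleWords (schroederShift Γ) n).Finite := by
  rw [admissibleWords_schroederShift]
  exact (List.finite_length_eq (SchroederLetter Γ) n).subset fun w hw => hw.2

theorem natCard_pathCode_le_ncard [Finite Γ] [Nonempty Γ] (n : ℕ) :
    Nat.card (PathCode Γ n .even) ≤ (admissibleWords (schroederShift Γ) n).ncard := by
  obtain ⟨γ⟩ := ‹Nonempty Γ›
  rw [← Set.ncard_range_of_injective (PathCode.labels_injective (fun _ => γ) n .even)]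
  refine Set.ncard_le_ncard ?_ (finite_admissibleWords n)
  rintro _ ⟨c, rfl⟩
  rw [admissibleWords_schroederShift]
  refine ⟨mem_schroederWords.2 ⟨_, (PathCode.startsAt_decode _ c).2, ?_, rfl⟩, ?_⟩
  · exact DyckMonoid.ne_zero_of_stackAction (PathCode.stackAction_decode _ c)
  · rw [PathCode.labels, List.length_map, PathCode.length_decode]

theorem exists_decode_of_prod_pos (s : ℕ → Γ) {p : List (SchroederEdge Γ)}
    (hp : (schroederGraph Γ).IsPath p) {u : List Γ}
    (hu : pathValue p = (u.map DyckMonoid.pos).prod) :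
    ∃ v, ∃ c : PathCode Γ p.length v, (c.decode s).1 = p := by
  obtain ⟨v, hv⟩ := exists_startsAt hp
  obtain ⟨t, ht⟩ := DyckMonoid.exists_stackAction_prod_pos u s
  rw [← hu] at ht
  obtain ⟨c, hc⟩ := PathCode.exists_decode_eq s hv ht
  exact ⟨v, c, by rw [hc]⟩

theorem ncard_le_sum_natCard_pathCode [Finite Γ] [Nonempty Γ] (n : ℕ) :
    (admissibleWords (schroederShift Γ) n).ncard ≤ ∑ k : Fin (n + 1),
      Nat.card ((Σ v, PathCode Γ k v) × (Σ v, PathCode Γ (n - k) v)) := by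
  obtain ⟨γ⟩ := ‹Nonempty Γ›
  have : Finite EvenVertex :=
    Finite.of_surjective (fun b : Bool => if b then EvenVertex.even else .odd)
      (by rintro (_ | _); exacts [⟨true, rfl⟩, ⟨false, rfl⟩])
  -- `k` is the length of the first factor. `f` may take inadmissible values; only that its range
  -- covers the language matters.
  let f : (Σ k : Fin (n + 1), (Σ v, PathCode Γ k v) × (Σ v, PathCode Γ (n - k) v)) →
      List (SchroederLetter Γ) := fun x =>
    ((x.2.1.2.decode fun _ => γ).1 ++ flipPath (x.2.2.2.decode fun _ => γ).1).map
      (schroederGraph Γ).label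
  have hf : admissibleWords (schroederShift Γ) n ⊆ Set.range f := by
    rw [admissibleWords_schroederShift]
    rintro w ⟨hw, hn⟩
    obtain ⟨p, hp, hv, rfl⟩ := mem_schroederWords.1 hw
    obtain ⟨p₁, p₂, u, v, rfl, h₁, h₂⟩ := exists_append_of_pathValue_ne_zero p hv
    obtain ⟨hp₁, hp₂, -⟩ := List.isChain_append.1 hp
    obtain ⟨v₁, c₁, hc₁⟩ := exists_decode_of_prod_pos (fun _ => γ) hp₁ h₁
    obtain ⟨v₂, c₂, hc₂⟩ := exists_decode_of_prod_pos (fun _ => γ) (isPath_flipPath hp₂)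
      (pathValue_flipPath_of_prod_neg h₂)
    have hl : (flipPath p₂).length = n - p₁.length := by
      simp only [List.length_map, List.length_append, flipPath, List.length_reverse] at hn ⊢
      omega
    have hk : p₁.length < n + 1 := by
      simp only [List.length_map, List.length_append] at hn
      omega
    have hc₂' : ∃ c : PathCode Γ (n - p₁.length) v₂, (c.decode fun _ => γ).1 = flipPath p₂ := by
      rw [← hl]
      exact ⟨c₂, hc₂⟩
    obtain ⟨c₂, hc₂⟩ := hc₂'
    exact ⟨⟨⟨p₁.length, hk⟩, ⟨v₁, c₁⟩, ⟨v₂, c₂⟩⟩, by simp only [f, hc₁, hc₂, flipPath_flipPath]⟩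
  calc (admissibleWords (schroederShift Γ) n).ncard
      ≤ (Set.range f).ncard := Set.ncard_le_ncard hf (Set.finite_range f)
    _ ≤ Nat.card (Σ k : Fin (n + 1), (Σ v, PathCode Γ k v) × (Σ v, PathCode Γ (n - k) v)) :=
        Finite.card_range_le f
    _ = _ := Nat.card_sigma

theorem natCard_sigma_pathCode [Finite Γ] (n : ℕ) :
    Nat.card (Σ v, PathCode Γ n v) =
      Nat.card (PathCode Γ n .even) + Nat.card (PathCode Γ n .odd) := by
  rw [← Nat.card_sum]
  refine Nat.card_congr ⟨fun x => match x with
    | ⟨.even, c⟩ => .inl c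
    | ⟨.odd, c⟩ => .inr c, Sum.elim (fun c => ⟨_, c⟩) (fun c => ⟨_, c⟩), ?_, ?_⟩
  · rintro ⟨_ | _, c⟩ <;> rfl
  · rintro (c | c) <;> rfl

end Language

/-! ### Growth of the number of codes, and the entropy -/

section Growth

variable {Γ : Type u} [Finite Γ] {r : ℝ}

/-- The recursion has the eigenvector `(r, 1)` with eigenvalue `r`. Scaled to `(1, 1/r)` it lies
below the initial counts `(1, 1)`, and the recursion is monotone. -/
theorem pow_le_natCard_pathCode (hr : 1 ≤ r) (h : r ^ 2 = (Nat.card Γ + 2) * r + 1) (n : ℕ) :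
    r ^ n ≤ Nat.card (PathCode Γ n .even) ∧ r ^ n ≤ r * Nat.card (PathCode Γ n .odd) := by
  induction n with
  | zero => simpa [PathCode.natCard_zero] using hr
  | succ n ih =>
    obtain ⟨h₁, h₂⟩ := ih
    rw [PathCode.natCard_succ_odd, PathCode.natCard_succ_even]
    push_cast
    refine ⟨le_of_mul_le_mul_left ?_ (zero_lt_one.trans_le hr), ?_⟩
    · calc r * r ^ (n + 1) = ((Nat.card Γ : ℝ) + 2) * r * r ^ n + r ^ n := by
            linear_combination r ^ n * h
        _ ≤ ((Nat.card Γ : ℝ) + 2) * r * Nat.card (PathCode Γ n .even) +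
            r * Nat.card (PathCode Γ n .odd) := by gcongr
        _ = _ := by ring
    · rw [pow_succ']
      gcongr

/-- The same eigenvector, unscaled, lies above the initial counts. -/
theorem natCard_pathCode_le_pow (hr : 1 ≤ r) (h : r ^ 2 = (Nat.card Γ + 2) * r + 1) (n : ℕ) :
    (Nat.card (PathCode Γ n .even) : ℝ) ≤ r ^ (n + 1) ∧
      (Nat.card (PathCode Γ n .odd) : ℝ) ≤ r ^ n := by
  induction n with
  | zero => simpa [PathCode.natCard_zero] using hr
  | succ n ih =>
    obtain ⟨h₁, h₂⟩ := ih
    rw [PathCode.natCard_succ_odd, PathCode.natCard_succ_even]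
    push_cast
    refine ⟨?_, h₁⟩
    calc ((Nat.card Γ : ℝ) + 2) * Nat.card (PathCode Γ n .even) + Nat.card (PathCode Γ n .odd)
        ≤ ((Nat.card Γ : ℝ) + 2) * r ^ (n + 1) + r ^ n := by gcongr
      _ = r ^ (n + 1 + 1) := by linear_combination -r ^ n * h

theorem natCard_sigma_pathCode_le_pow (hr : 1 ≤ r) (h : r ^ 2 = (Nat.card Γ + 2) * r + 1)
    (n : ℕ) : (Nat.card (Σ v, PathCode Γ n v) : ℝ) ≤ 2 * r ^ (n + 1) := by
  obtain ⟨h₁, h₂⟩ := natCard_pathCode_le_pow hr h n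
  have h₃ : r ^ n ≤ r ^ (n + 1) := pow_le_pow_right₀ hr n.le_succ
  rw [natCard_sigma_pathCode]
  push_cast
  linarith

theorem ncard_admissibleWords_le [Nonempty Γ] (hr : 1 ≤ r)
    (h : r ^ 2 = (Nat.card Γ + 2) * r + 1) (n : ℕ) :
    ((admissibleWords (schroederShift Γ) n).ncard : ℝ) ≤ r ^ n * (4 * r ^ 2 * (n + 1)) := by
  calc ((admissibleWords (schroederShift Γ) n).ncard : ℝ)
      ≤ ∑ k : Fin (n + 1),
          (Nat.card ((Σ v, PathCode Γ k v) × (Σ v, PathCode Γ (n - k) v)) : ℝ) := by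
        exact_mod_cast ncard_le_sum_natCard_pathCode n
    _ ≤ ∑ _k : Fin (n + 1), r ^ n * (4 * r ^ 2) := by
        refine Finset.sum_le_sum fun k _ => ?_
        rw [Nat.card_prod]
        push_cast
        calc (Nat.card (Σ v, PathCode Γ k v) : ℝ) * Nat.card (Σ v, PathCode Γ (n - k) v)
            ≤ (2 * r ^ ((k : ℕ) + 1)) * (2 * r ^ (n - k + 1)) := by
              gcongr <;> exact natCard_sigma_pathCode_le_pow hr h _
          _ = r ^ (k + (n - k)) * (4 * r ^ 2) := by ring
          _ = r ^ n * (4 * r ^ 2) := by rw [Nat.add_sub_cancel' (by omega)]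
    _ = r ^ n * (4 * r ^ 2 * (n + 1)) := by
        simp only [Finset.sum_const, Finset.card_univ, Fintype.card_fin, nsmul_eq_mul]
        push_cast
        ring

theorem hasTopologicalEntropy_schroederShift [Nonempty Γ] (hr : 1 < r)
    (h : r ^ 2 = (Nat.card Γ + 2) * r + 1) :
    HasTopologicalEntropy (schroederShift Γ) (Real.log r) := by
  have hr₀ : 0 < r := zero_lt_one.trans hr
  have hlog : Tendsto (fun n : ℕ => Real.log (n + 1) / n) atTop (𝓝 0) := by
    -- The limit of `log x / (x - 1)` at infinity, taken along `x = n + 1`.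
    have := (Real.tendsto_pow_log_div_mul_add_atTop 1 (-1) 1 one_ne_zero).comp
      (tendsto_natCast_atTop_atTop.atTop_add (tendsto_const_nhds (x := (1 : ℝ))))
    refine this.congr fun n => ?_
    simp
  have hupper : Tendsto
      (fun n : ℕ => Real.log r + (Real.log (4 * r ^ 2) / n + Real.log (n + 1) / n)) atTop
      (𝓝 (Real.log r)) := by
    simpa using tendsto_const_nhds.add ((tendsto_const_div_atTop_nhds_zero_nat _).add hlog)
  refine tendsto_of_tendsto_of_tendsto_of_le_of_le' tendsto_const_nhds hupper ?_ ?_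
  all_goals
    filter_upwards [eventually_gt_atTop 0] with n hn
    have hn' : (0 : ℝ) < n := by exact_mod_cast hn
    have hlow : r ^ n ≤ ((admissibleWords (schroederShift Γ) n).ncard : ℝ) :=
      (pow_le_natCard_pathCode hr.le h n).1.trans (by exact_mod_cast natCard_pathCode_le_ncard n)
  · rw [one_div, le_inv_mul_iff₀ hn', ← Real.log_pow]
    exact Real.log_le_log (by positivity) hlow
  · rw [one_div, inv_mul_le_iff₀ hn']
    calc Real.log ((admissibleWords (schroederShift Γ) n).ncard : ℝ)
        ≤ Real.log (r ^ n * (4 * r ^ 2 * (n + 1))) :=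
          Real.log_le_log ((pow_pos hr₀ n).trans_le hlow) (ncard_admissibleWords_le hr.le h n)
      _ = n * Real.log r + (Real.log (4 * r ^ 2) + Real.log (n + 1)) := by
          rw [Real.log_mul (by positivity) (by positivity), Real.log_pow,
            Real.log_mul (by positivity) (by positivity)]
      _ = n * (Real.log r + (Real.log (4 * r ^ 2) / n + Real.log (n + 1) / n)) := by
          field_simp

end Growth

end DyckExtension

theorem corollary2p10 (Γ : Type*) [Fintype Γ] (N : ℕ) (hcard : Fintype.card Γ = N) (hN : 1 < N) :
    DyckExtension.HasTopologicalEntropy (DyckExtension.schroederShift Γ)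
      (Real.log 2 - Real.log (Real.sqrt (((N : ℝ) + 2) ^ 2 + 4) - (N : ℝ) - 2)) := by
  have : Nonempty Γ := Fintype.card_pos_iff.1 (by omega)
  set q := Real.sqrt (((N : ℝ) + 2) ^ 2 + 4) with hq
  have hN₀ : (0 : ℝ) ≤ N := N.cast_nonneg
  have hsq : q ^ 2 = ((N : ℝ) + 2) ^ 2 + 4 := Real.sq_sqrt (by positivity)
  have hlt : (N : ℝ) + 2 < q := Real.lt_sqrt_of_sq_lt (by linarith)
  have hpos : 0 < q - N - 2 := by linarith
  -- Rationalizing with `(q - N - 2) * (q + N + 2) = 4` exhibits the positive root of `r ^ 2 = (N +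
  -- 2) * r + 1`.
  have hr : 2 / (q - N - 2) = (q + N + 2) / 2 := by
    rw [div_eq_div_iff hpos.ne' two_ne_zero]
    linear_combination -hsq
  rw [← Real.log_div two_ne_zero hpos.ne', hr]
  refine DyckExtension.hasTopologicalEntropy_schroederShift (by linarith) ?_
  rw [Nat.card_eq_fintype_card, hcard]
  linear_combination hsq / 4
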